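/- **Setting.** Let $\varrho$ be a primitive substitution on a finite alphabet $\mathcal A$ (primitive means that some power of the substitution matrix $M$, with $M_{ij}$ the number of letters $i$ in $\varrho(j)$, has only positive entries). Let $\ell=(\ell_i)_{i\in\mathcal A}$ be a strictly positive left eigenvector of $M$, so $\ell M=\lambda\ell$, with $\lambda>1$. Thus $\varrho$ defines an inflation rule with multiplier $\lambda$, for prototiles of type $i$ that are intervals of natural length $\ell_i$: expand each tile by $\lambda$, then dissect it according to $\varrho$. The inflation may be periodic or aperiodic. Let $T_{ij}\subset\mathbb R$ be the finite set of left endpoints of the tiles of type $i$ in the patch $\varrho(j)$ that starts at $0$. The renormalisation equations for functions $\nu_{ij}:\mathbb R\to\mathbb R$ $(i,j\in\mathcal A)$ are $$\nu_{mn}(z)=\frac1\lambda\sum_{i,j\in\mathcal A}\ \sum_{x\in T_{mi}}\ \sum_{y\in T_{nj}}\nu_{ij}\Bigl(\frac{z+x-y}{\lambda}\Bigr)\qquad\text{for all } m,n\in\mathcal A,\ z\in\mathbb R. \tag{RE}$$ For a family $\Delta_{ij}\subset\mathbb R$, let $V(\Delta)$ be the real vector space of all families $(\nu_{ij})$ that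 satisfy (RE) and for which $\nu_{ij}$ vanishes outside $\Delta_{ij}$, for all $i,j$. Let $\mathcal T$ be a legal tiling of $\mathbb R$ (every finite patch occurs, up to translation, in some iterate $\varrho^k(a)$) that is fixed by the inflation rule or by one of its powers, and let $\mathbb Y$ be its hull, the closure of its translation orbit in the local topology. Let $\Lambda\in\mathbb Y$, write $\Lambda_i$ for the set of left endpoints of its tiles of type $i$, and put $S_{ij}=\Lambda_j-\Lambda_i=\{q-p: q\in\Lambda_j,\ p\in\Lambda_i\}$. **Theorem.** 1. If $\bigcup_{i,j}\Delta_{ij}$ is locally finite (it meets every compact set in a finite set) and contains $0$, then $V(\Delta)$ is finite-dimensional. If, in addition, $S_{ij}\subseteq\Delta_{ij}$ for all $i,j$, then $V(\Delta)\neq\{0\}$. 2. $\dim V(S)=1$. There is precisely one $\nu\in V(S)$ with $\sum_{i}\nu_{ii}(0)=1$. It satisfies $\nu_{ij}(z)>0$ for all $i,j$ and all $z\in S_{ij}$, and $\nu_{ij}(-z)=\nu_{ji}(z)$ for all $i,j$ and all $z\in\mathbb R$. 3. If $\Delta_{ij}\subseteq S_{ij}$ for all $i,j$, with $\Delta_{ij}\neq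 S_{ij}$ for at least one pair $(i,j)$, then $V(\Delta)=\{0\}$. -/

import Mathlib

open scoped Pointwise

namespace PairCorr

noncomputable section

variable {A : Type*}

/-- Natural length of a finite word: the sum of the lengths of its letters. -/
def wordLength (ℓ : A → ℝ) (w : List A) : ℝ := (w.map ℓ).sum

/-- Substitution matrix: entry `(i, j)` is the number of letters `i` in `ρ j`. -/
def substMatrix [DecidableEq A] (ρ : A → List A) : Matrix A A ℝ :=
  Matrix.of fun i j => ((ρ j).count i : ℝ)

/-- `ρ` is a primitive substitution, turned into an inflation rule with inflation multiplier
`lam > 1` by giving the prototile of type `i` its natural length `ℓ i`: the matrix of `ρ` is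
primitive and `ℓ` is a strictly positive left eigenvector for `lam`. (By Perron and Frobenius,
`lam` is then the leading eigenvalue, and `ℓ` is unique up to a common factor.) -/
structure IsPrimitiveInflation [Fintype A] [DecidableEq A]
    (ρ : A → List A) (lam : ℝ) (ℓ : A → ℝ) : Prop where
  primitive : (substMatrix ρ).IsPrimitive
  one_lt : 1 < lam
  length_pos : ∀ i, 0 < ℓ i
  eigenvector : Matrix.vecMul ℓ (substMatrix ρ) = lam • ℓ

/-- Displacement set `T i j`: the positions of the left endpoints of all tiles of type `i` in the
patch `ρ j` (which starts at `0`). The `k`-th tile sits at the total length of the first `k`. -/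
def displacement [DecidableEq A] (ρ : A → List A) (ℓ : A → ℝ) (i j : A) : Finset ℝ :=
  ((Finset.range (ρ j).length).filter fun k => (ρ j)[k]? = some i).image
    fun k => wordLength ℓ ((ρ j).take k)

/-! A coloured point set is a family `Λ : A → Set ℝ`; the points of `Λ i` are the left endpoints
of the tiles (intervals) of type `i` and length `ℓ i`. -/

/-- The tiles `[p, p + ℓ i)`, with `p ∈ Λ i`, cover every point of the line exactly once. -/
def IsTiling (ℓ : A → ℝ) (Λ : A → Set ℝ) : Prop :=
  ∀ y : ℝ, ∃! p : ℝ × A, p.1 ∈ Λ p.2 ∧ y ∈ Set.Ico p.1 (p.1 + ℓ p.2)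

/-- One inflation step: a tile of type `j` at `u` is expanded to a supertile at `lam * u`,
which is dissected into the tiles of `ρ j`. -/
def inflate [DecidableEq A] (ρ : A → List A) (lam : ℝ) (ℓ : A → ℝ) (Λ : A → Set ℝ) :
    A → Set ℝ :=
  fun i => {p | ∃ j, ∃ u ∈ Λ j, ∃ x ∈ displacement ρ ℓ i j, p = lam * u + x}

/-- Translation of a coloured point set. -/
def shift (t : ℝ) (Λ : A → Set ℝ) : A → Set ℝ := fun i => (fun p => t + p) '' Λ i

/-- The patch that consists of a single tile of type `a` with left endpoint `0`. -/
def singleTile (a : A) : A → Set ℝ := fun i => {p | i = a ∧ p = 0}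

/-- The supertile of level `k` and type `a`. -/
def supertile [DecidableEq A] (ρ : A → List A) (lam : ℝ) (ℓ : A → ℝ) (k : ℕ) (a : A) :
    A → Set ℝ :=
  (inflate ρ lam ℓ)^[k] (singleTile a)

/-- Legality: every finite patch occurs, up to translation, in some supertile. -/
def IsLegal [DecidableEq A] (ρ : A → List A) (lam : ℝ) (ℓ : A → ℝ) (Λ : A → Set ℝ) : Prop :=
  ∀ R : ℝ, ∃ (k : ℕ) (a : A) (t : ℝ),
    ∀ i, Λ i ∩ Set.Icc (-R) R ⊆ shift t (supertile ρ lam ℓ k a) i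

/-- A (legal) fixed point tiling of the line under the inflation rule or one of its powers. -/
structure IsFixedPointTiling [DecidableEq A] (ρ : A → List A) (lam : ℝ) (ℓ : A → ℝ)
    (Λ : A → Set ℝ) : Prop where
  tiling : IsTiling ℓ Λ
  legal : IsLegal ρ lam ℓ Λ
  fixed : ∃ q : ℕ, 0 < q ∧ (inflate ρ lam ℓ)^[q] Λ = Λ

/-- Closeness in the local topology: after translations by at most `ε`, the two coloured point
sets agree on `[-1/ε, 1/ε]`. -/
def LocallyClose (ε : ℝ) (Λ Λ' : A → Set ℝ) : Prop :=
  ∃ s : ℝ, |s| ≤ ε ∧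
    ∀ i, shift s Λ i ∩ Set.Icc (-(1 / ε)) (1 / ε) = Λ' i ∩ Set.Icc (-(1 / ε)) (1 / ε)

/-- The hull of `T`: the closure of its translation orbit in the local topology. -/
def hull (T : A → Set ℝ) : Set (A → Set ℝ) :=
  {Λ | ∀ ε : ℝ, 0 < ε → ∃ t : ℝ, LocallyClose ε Λ (shift t T)}

/-- The Minkowski difference `S i j = Λ j - Λ i`. -/
def distSet (Λ : A → Set ℝ) (i j : A) : Set ℝ := Λ j - Λ i

/-- A set of reals is locally finite if it meets every compact set in a finite set. -/
def IsLocallyFinite (D : Set ℝ) : Prop := ∀ K : Set ℝ, IsCompact K → (D ∩ K).Finite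

/-- The renormalisation equations, for all types `m n` and all real `z`. -/
def SatisfiesRE [Fintype A] [DecidableEq A] (ρ : A → List A) (lam : ℝ) (ℓ : A → ℝ)
    (ν : A → A → ℝ → ℝ) : Prop :=
  ∀ m n z, ν m n z = 1 / lam * ∑ i, ∑ j, ∑ x ∈ displacement ρ ℓ m i, ∑ y ∈ displacement ρ ℓ n j,
    ν i j ((z + x - y) / lam)

/-- The space of solutions of the renormalisation equations whose `(i, j)` component is supported
in `Δ i j`. -/
def solutionSpace [Fintype A] [DecidableEq A] (ρ : A → List A) (lam : ℝ) (ℓ : A → ℝ)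
    (Δ : A → A → Set ℝ) : Submodule ℝ (A → A → ℝ → ℝ) where
  carrier := {ν | (∀ i j, Function.support (ν i j) ⊆ Δ i j) ∧ SatisfiesRE ρ lam ℓ ν}
  zero_mem' := ⟨fun i j => by simp, fun m n z => by simp⟩
  add_mem' := by
    rintro f g ⟨hf, hf'⟩ ⟨hg, hg'⟩
    refine ⟨fun i j => (Function.support_add (f i j) (g i j)).trans
      (Set.union_subset (hf i j) (hg i j)), fun m n z => ?_⟩
    simp only [Pi.add_apply, Finset.sum_add_distrib, mul_add]
    rw [hf' m n z, hg' m n z]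
  smul_mem' := by
    rintro c f ⟨hf, hf'⟩
    refine ⟨fun i j => (Function.support_const_smul_subset c (f i j)).trans (hf i j),
      fun m n z => ?_⟩
    simp only [Pi.smul_apply, smul_eq_mul, ← Finset.mul_sum]
    rw [hf' m n z]
    ring

end

end PairCorr

/-! The solution is built as a monotone limit of pair counts, and the same limit forces uniqueness.

Existence. Let `v` be the positive right Perron eigenvector, with `v` normalised to sum 1. Start
with the family that equals `v m` for `m = n`, `z = 0` and vanishes elsewhere. Its iterates under
the right-hand side of (RE) are the functions `approxFreq`, which count pairs of tiles in
supertiles, weighted by `v` and rescaled (`approxFreq_succ`). The values at `0` stay equal to `v`,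
so the first step increases the family. The operator has nonnegative coefficients, so every step
does (`approxFreq_monotone`). A pair is determined by its first tile, which gives the bound `v m`.
The limit `pairFreq` solves (RE) and is positive exactly on the distances that occur in supertiles.

Supports. By legality, and by recurrence with bounded gaps, these distances form the set `S` of
every element of the hull (`distSet_eq_superDist`).

Uniqueness. Tiles of distinct supertiles never overlap, so at `z = 0` (RE) reduces to an eigenvector
equation for the numbers `ν i i 0`; they are therefore a multiple of `v`. It remains to show that a
solution on `S` that vanishes at `0` is zero (`eq_zero_of_apply_zero`). On a bounded window that
(RE) maps into itself, such a solution is at most `c * pairFreq` in modulus; iterating improves this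
to `c * (pairFreq - approxFreq k)`, which tends to 0. Strict positivity on `S` excludes nonzero
solutions with smaller support.

Finite dimension. (RE) contracts arguments by `1 / lam` up to a bounded shift, so a solution is
determined by its values on a fixed window. -/

namespace PairCorr

/-! ### Tile positions in the patch of a finite word -/

section Words

variable {A : Type*}

@[simp]
theorem wordLength_nil (ℓ : A → ℝ) : wordLength ℓ [] = 0 := rfl

@[simp]
theorem wordLength_cons (ℓ : A → ℝ) (a : A) (w : List A) :
    wordLength ℓ (a :: w) = ℓ a + wordLength ℓ w := by
  simp [wordLength]

theorem wordLength_nonneg {ℓ : A → ℝ} (hℓ : ∀ i, 0 < ℓ i) (w : List A) : 0 ≤ wordLength ℓ w := by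
  induction w with
  | nil => simp
  | cons a w ih => rw [wordLength_cons]; linarith [hℓ a]

/-- The word `ρ ^ k (a)`. -/
def superword (ρ : A → List A) (k : ℕ) (a : A) : List A := (fun w => w.flatMap ρ)^[k] [a]

theorem superword_succ (ρ : A → List A) (k : ℕ) (a : A) :
    superword ρ (k + 1) a = (superword ρ k a).flatMap ρ :=
  Function.iterate_succ_apply' _ _ _

variable [DecidableEq A]

/-- The positions of the letter `i` in the patch of tiles described by the word `w`. -/
noncomputable def positions (ℓ : A → ℝ) : List A → A → Finset ℝ
  | [], _ => ∅
  | a :: w, i => (if a = i then {0} else ∅) ∪ (positions ℓ w i).image (ℓ a + ·)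

theorem mem_positions_cons {ℓ : A → ℝ} {a i : A} {w : List A} {p : ℝ} :
    p ∈ positions ℓ (a :: w) i ↔ (a = i ∧ p = 0) ∨ ∃ u ∈ positions ℓ w i, ℓ a + u = p := by
  simp only [positions, Finset.mem_union, Finset.mem_image]
  by_cases h : a = i <;> simp [h]

theorem mem_positions {ℓ : A → ℝ} {i : A} {w : List A} {p : ℝ} :
    p ∈ positions ℓ w i ↔ ∃ k, w[k]? = some i ∧ wordLength ℓ (w.take k) = p := by
  induction w generalizing p with
  | nil => simp [positions]
  | cons a w ih =>
    rw [mem_positions_cons]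
    constructor
    · rintro (⟨rfl, rfl⟩ | ⟨u, hu, rfl⟩)
      · exact ⟨0, by simp, by simp⟩
      · obtain ⟨k, hk, rfl⟩ := ih.1 hu
        exact ⟨k + 1, by simpa using hk, by simp⟩
    · rintro ⟨_ | k, hk, rfl⟩
      · exact Or.inl ⟨by simpa using hk, by simp⟩
      · exact Or.inr ⟨_, ih.2 ⟨k, by simpa using hk, rfl⟩, by simp⟩

theorem displacement_eq_positions (ρ : A → List A) (ℓ : A → ℝ) (i j : A) :
    displacement ρ ℓ i j = positions ℓ (ρ j) i := by
  ext p
  rw [mem_positions]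
  simp only [displacement, Finset.mem_image, Finset.mem_filter, Finset.mem_range]
  refine exists_congr fun k => and_congr_left fun _ => ⟨fun h => h.2, fun h => ⟨?_, h⟩⟩
  exact (List.getElem?_eq_some_iff.1 h).1

theorem mem_positions_append {ℓ : A → ℝ} {i : A} {w w' : List A} {p : ℝ} :
    p ∈ positions ℓ (w ++ w') i ↔
      p ∈ positions ℓ w i ∨ ∃ u ∈ positions ℓ w' i, wordLength ℓ w + u = p := by
  induction w generalizing p with
  | nil => simp [positions]
  | cons a w ih =>
    simp only [List.cons_append, mem_positions_cons, ih, wordLength_cons, or_assoc]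
    refine or_congr_right ?_
    constructor
    · rintro ⟨u, hu | ⟨u', hu', rfl⟩, rfl⟩
      · exact Or.inl ⟨u, hu, rfl⟩
      · exact Or.inr ⟨u', hu', by ring⟩
    · rintro (⟨u, hu, rfl⟩ | ⟨u', hu', rfl⟩)
      · exact ⟨u, Or.inl hu, rfl⟩
      · exact ⟨_, Or.inr ⟨u', hu', rfl⟩, by ring⟩

theorem positions_bounds {ℓ : A → ℝ} (hℓ : ∀ i, 0 < ℓ i) {i : A} {w : List A} {p : ℝ}
    (hp : p ∈ positions ℓ w i) : 0 ≤ p ∧ p + ℓ i ≤ wordLength ℓ w := by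
  induction w generalizing p with
  | nil => simp [positions] at hp
  | cons a w ih =>
    have := wordLength_nonneg hℓ w
    have := hℓ a
    rw [wordLength_cons]
    obtain ⟨rfl, rfl⟩ | ⟨u, hu, rfl⟩ := mem_positions_cons.1 hp
    · constructor <;> linarith
    · have := ih hu
      constructor <;> linarith

/-- Two tiles of a patch are equal or do not overlap. -/
theorem positions_separated {ℓ : A → ℝ} (hℓ : ∀ i, 0 < ℓ i) {i j : A} {w : List A} {p q : ℝ}
    (hp : p ∈ positions ℓ w i) (hq : q ∈ positions ℓ w j) :
    (i = j ∧ p = q) ∨ p + ℓ i ≤ q ∨ q + ℓ j ≤ p := by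
  induction w generalizing p q with
  | nil => simp [positions] at hp
  | cons a w ih =>
    obtain ⟨rfl, rfl⟩ | ⟨u, hu, rfl⟩ := mem_positions_cons.1 hp <;>
      obtain ⟨rfl, rfl⟩ | ⟨v, hv, rfl⟩ := mem_positions_cons.1 hq
    · simp
    · have := positions_bounds hℓ hv
      exact Or.inr (Or.inl (by linarith))
    · have := positions_bounds hℓ hu
      exact Or.inr (Or.inr (by linarith))
    · rcases ih hu hv with ⟨h, rfl⟩ | h | h
      · exact Or.inl ⟨h, rfl⟩
      · exact Or.inr (Or.inl (by linarith))
      · exact Or.inr (Or.inr (by linarith))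

/-- The tiles between two given ones spell a word. This makes the set of distances locally finite.
-/
theorem exists_sub_eq_wordLength {ℓ : A → ℝ} {i j : A} {w : List A} {p q : ℝ}
    (hp : p ∈ positions ℓ w i) (hq : q ∈ positions ℓ w j) :
    ∃ l : List A, q - p = wordLength ℓ l ∨ q - p = -wordLength ℓ l := by
  induction w generalizing p q with
  | nil => simp [positions] at hp
  | cons a w ih =>
    obtain ⟨-, rfl⟩ | ⟨u, hu, rfl⟩ := mem_positions_cons.1 hp
    · obtain ⟨k, -, rfl⟩ := mem_positions.1 hq
      exact ⟨_, Or.inl (sub_zero _)⟩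
    · obtain ⟨-, rfl⟩ | ⟨v, hv, rfl⟩ := mem_positions_cons.1 hq
      · obtain ⟨k, -, h⟩ := mem_positions.1 hp
        exact ⟨_, Or.inr (by rw [h]; ring)⟩
      · obtain ⟨l, hl⟩ := ih hu hv
        exact ⟨l, by rwa [add_sub_add_left_eq_sub]⟩

theorem sum_positions_cons {ℓ : A → ℝ} (hℓ : ∀ i, 0 < ℓ i) (a i : A) (w : List A) (g : ℝ → ℝ) :
    ∑ p ∈ positions ℓ (a :: w) i, g p =
      (if a = i then g 0 else 0) + ∑ p ∈ positions ℓ w i, g (ℓ a + p) := by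
  rw [positions, Finset.sum_union, Finset.sum_image (by simp)]
  · by_cases h : a = i <;> simp [h]
  -- Positive lengths keep the shifted positions away from `0`, so no position is counted twice.
  · rw [Finset.disjoint_left]
    intro p hp hp'
    obtain ⟨u, hu, rfl⟩ := Finset.mem_image.1 hp'
    have h0 := (positions_bounds hℓ hu).1
    have := hℓ a
    split_ifs at hp with h
    · have := Finset.mem_singleton.1 hp
      linarith
    · simp at hp

theorem sum_positions_append {ℓ : A → ℝ} (hℓ : ∀ i, 0 < ℓ i) (i : A) (w w' : List A)
    (g : ℝ → ℝ) :
    ∑ p ∈ positions ℓ (w ++ w') i, g p =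
      ∑ p ∈ positions ℓ w i, g p + ∑ p ∈ positions ℓ w' i, g (wordLength ℓ w + p) := by
  induction w generalizing g with
  | nil => simp [positions]
  | cons a w ih =>
    rw [List.cons_append, sum_positions_cons hℓ, sum_positions_cons hℓ, ih]
    simp only [wordLength_cons, add_assoc]

theorem card_positions {ℓ : A → ℝ} (hℓ : ∀ i, 0 < ℓ i) (w : List A) (i : A) :
    ((positions ℓ w i).card : ℝ) = w.count i := by
  have key : ∑ p ∈ positions ℓ w i, (1 : ℝ) = w.count i := by
    induction w with
    | nil => simp [positions]
    | cons a w ih =>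
      rw [sum_positions_cons hℓ a i w fun _ => 1, ih, List.count_cons]
      by_cases h : a = i <;> simp [h, add_comm]
  simpa using key

end Words

/-! ### Inflation as substitution of words -/

section Inflation

variable {A : Type*} [Fintype A] [DecidableEq A] {ρ : A → List A} {lam : ℝ} {ℓ : A → ℝ}

theorem wordLength_eq_sum_count (ℓ : A → ℝ) (w : List A) :
    wordLength ℓ w = ∑ i, ℓ i * (w.count i : ℝ) := by
  induction w with
  | nil => simp
  | cons a w ih =>
    simp only [wordLength_cons, ih, List.count_cons, Nat.cast_add, mul_add,
      Finset.sum_add_distrib]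
    rw [add_comm]
    simp

theorem IsPrimitiveInflation.lam_pos (hρ : IsPrimitiveInflation ρ lam ℓ) : 0 < lam :=
  zero_lt_one.trans hρ.one_lt

/-- The left eigenvector equation, read geometrically: the patch `ρ a` exactly fills the expanded
tile. -/
theorem IsPrimitiveInflation.wordLength_image (hρ : IsPrimitiveInflation ρ lam ℓ) (a : A) :
    wordLength ℓ (ρ a) = lam * ℓ a := by
  have h := congrFun hρ.eigenvector a
  simpa [wordLength_eq_sum_count, Matrix.vecMul, dotProduct, substMatrix] using h

theorem IsPrimitiveInflation.mem_positions_flatMap (hρ : IsPrimitiveInflation ρ lam ℓ)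
    {w : List A} {m : A} {p : ℝ} :
    p ∈ positions ℓ (w.flatMap ρ) m ↔
      ∃ i, ∃ u ∈ positions ℓ w i, ∃ x ∈ positions ℓ (ρ i) m, p = lam * u + x := by
  induction w generalizing p with
  | nil => simp [positions]
  | cons a w ih =>
    simp only [List.flatMap_cons, mem_positions_append, mem_positions_cons, ih,
      hρ.wordLength_image]
    constructor
    · rintro (h | ⟨_, ⟨i, u, hu, x, hx, rfl⟩, rfl⟩)
      · exact ⟨a, 0, Or.inl ⟨rfl, rfl⟩, p, h, by ring⟩
      · exact ⟨i, _, Or.inr ⟨u, hu, rfl⟩, x, hx, by ring⟩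
    · rintro ⟨i, _, ⟨rfl, rfl⟩ | ⟨u, hu, rfl⟩, x, hx, rfl⟩
      · exact Or.inl (by simpa using hx)
      · exact Or.inr ⟨_, ⟨i, u, hu, x, hx, rfl⟩, by ring⟩

theorem IsPrimitiveInflation.sum_positions_flatMap (hρ : IsPrimitiveInflation ρ lam ℓ)
    (w : List A) (m : A) (g : ℝ → ℝ) :
    ∑ p ∈ positions ℓ (w.flatMap ρ) m, g p =
      ∑ i, ∑ u ∈ positions ℓ w i, ∑ x ∈ positions ℓ (ρ i) m, g (lam * u + x) := by
  induction w generalizing g with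
  | nil => simp [positions]
  | cons a w ih =>
    simp only [List.flatMap_cons]
    rw [sum_positions_append hρ.length_pos, ih, hρ.wordLength_image]
    simp only [sum_positions_cons hρ.length_pos a _ w, Finset.sum_add_distrib]
    congr 1
    · simp
    · simp only [mul_add, add_assoc]

theorem inflate_positions (hρ : IsPrimitiveInflation ρ lam ℓ) (w : List A) :
    inflate ρ lam ℓ (fun i => (positions ℓ w i : Set ℝ)) =
      fun i => (positions ℓ (w.flatMap ρ) i : Set ℝ) := by
  ext m p
  simp [inflate, hρ.mem_positions_flatMap, displacement_eq_positions]

theorem supertile_eq_positions (hρ : IsPrimitiveInflation ρ lam ℓ) (k : ℕ) (a : A) :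
    supertile ρ lam ℓ k a = fun i => (positions ℓ (superword ρ k a) i : Set ℝ) := by
  induction k with
  | zero =>
    ext i p
    simp [supertile, superword, singleTile, mem_positions_cons, show positions ℓ [] i = ∅ from rfl,
      eq_comm (a := a)]
  | succ k ih =>
    rw [superword_succ, ← inflate_positions hρ, ← ih, supertile, supertile,
      Function.iterate_succ_apply']

theorem count_flatMap_eq_sum (ρ : A → List A) (w : List A) (m : A) :
    ((w.flatMap ρ).count m : ℝ) = ∑ i, substMatrix ρ m i * (w.count i : ℝ) := by
  induction w with
  | nil => simp
  | cons a w ih =>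
    simp only [List.flatMap_cons, List.count_append, Nat.cast_add, ih, List.count_cons, mul_add,
      Finset.sum_add_distrib]
    rw [add_comm]
    simp [substMatrix]

theorem count_superword (ρ : A → List A) (k : ℕ) (m a : A) :
    ((superword ρ k a).count m : ℝ) = (substMatrix ρ ^ k) m a := by
  induction k generalizing m with
  | zero => simp [superword, List.count_cons, Matrix.one_apply, eq_comm (a := a)]
  | succ k ih => rw [superword_succ, count_flatMap_eq_sum, pow_succ', Matrix.mul_apply]; simp [ih]

end Inflation

/-! ### Distances in supertiles and in elements of the hull -/

section Geometry

theorem finite_setOf_wordLength_le {A : Type*} [Finite A] {ℓ : A → ℝ}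
    (hℓ : ∀ i, 0 < ℓ i) (R : ℝ) :
    {w : List A | wordLength ℓ w ≤ R}.Finite := by
  rcases isEmpty_or_nonempty A with hA | hA
  · exact (Set.finite_singleton []).subset fun w _ => Subsingleton.elim _ _
  obtain ⟨b, hb⟩ := Finite.exists_min ℓ
  refine (List.finite_length_le A ⌊R / ℓ b⌋₊).subset fun w hw => ?_
  have key : (w.length : ℝ) * ℓ b ≤ wordLength ℓ w := by
    clear hw
    induction w with
    | nil => simp
    | cons a w ih =>
      rw [wordLength_cons, List.length_cons, Nat.cast_add_one, add_mul, one_mul]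
      linarith [hb a]
  exact Nat.le_floor ((le_div_iff₀ (hℓ b)).2 (key.trans hw))

variable {A : Type*} [DecidableEq A]

/-- The distances from a tile of type `i` to a tile of type `j` in a common supertile. -/
def superDist (ρ : A → List A) (ℓ : A → ℝ) (i j : A) : Set ℝ :=
  {z | ∃ k a, ∃ p ∈ positions ℓ (superword ρ k a) i, p + z ∈ positions ℓ (superword ρ k a) j}

theorem neg_mem_superDist {ρ : A → List A} {ℓ : A → ℝ} {i j : A} {z : ℝ} :
    -z ∈ superDist ρ ℓ i j ↔ z ∈ superDist ρ ℓ j i := by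
  constructor
  · rintro ⟨k, a, p, hp, hq⟩
    exact ⟨k, a, _, hq, by simpa using hp⟩
  · rintro ⟨k, a, p, hp, hq⟩
    exact ⟨k, a, _, hq, by simpa using hp⟩

variable [Fintype A] {ρ : A → List A} {lam : ℝ} {ℓ : A → ℝ}

/-- Tiles of two supertiles can only coincide if the supertiles do. -/
theorem eq_of_sub_div_mem_superDist (hρ : IsPrimitiveInflation ρ lam ℓ) {i j m n : A} {x y : ℝ}
    (hx : x ∈ positions ℓ (ρ i) m) (hy : y ∈ positions ℓ (ρ j) n)
    (h : (x - y) / lam ∈ superDist ρ ℓ i j) : i = j ∧ x = y := by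
  obtain ⟨k, a, p, hp, hq⟩ := h
  have hlam := hρ.lam_pos
  have hx' := positions_bounds hρ.length_pos hx
  have hy' := positions_bounds hρ.length_pos hy
  rw [hρ.wordLength_image] at hx' hy'
  have hm := hρ.length_pos m
  have hn := hρ.length_pos n
  have hd : lam * ((x - y) / lam) = x - y := mul_div_cancel₀ _ hlam.ne'
  rcases positions_separated hρ.length_pos hp hq with ⟨h, h'⟩ | h | h
  · refine ⟨h, ?_⟩
    rw [left_eq_add.1 h'] at hd
    linarith
  -- Scaled by `lam`, a gap of a full tile exceeds what two offsets inside supertiles can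
  -- compensate.
  · have := mul_le_mul_of_nonneg_left h hlam.le
    rw [mul_add, mul_add, hd] at this
    linarith
  · have := mul_le_mul_of_nonneg_left h hlam.le
    rw [mul_add, mul_add, hd] at this
    linarith

theorem superDist_inter_finite (hℓ : ∀ i, 0 < ℓ i) (i j : A) (R : ℝ) :
    {z | z ∈ superDist ρ ℓ i j ∧ |z| ≤ R}.Finite := by
  have h := (finite_setOf_wordLength_le hℓ R).image (wordLength ℓ)
  refine (h.union h.neg).subset ?_
  rintro z ⟨⟨k, a, p, hp, hq⟩, hz⟩
  obtain ⟨l, hl⟩ := exists_sub_eq_wordLength hp hq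
  rw [add_sub_cancel_left] at hl
  rcases hl with hl | hl
  · exact Or.inl ⟨l, hl.symm.le.trans ((le_abs_self z).trans hz), hl.symm⟩
  · refine Or.inr (Set.mem_neg.2 ⟨l, ?_, by rw [hl, neg_neg]⟩)
    have := (neg_le_abs z).trans hz
    rwa [hl, neg_neg] at this

/-- A positive power rules out zero rows in the matrix, so positivity passes to all later powers. -/
theorem IsPrimitiveInflation.exists_forall_pow_pos (hρ : IsPrimitiveInflation ρ lam ℓ) :
    ∃ K, ∀ r, K ≤ r → ∀ a b, 0 < (substMatrix ρ ^ r) a b := by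
  obtain ⟨hnonneg, K, hK, hpos⟩ := hρ.primitive
  refine ⟨K, fun r hr => ?_⟩
  induction r, hr using Nat.le_induction with
  | base => exact hpos
  | succ r hr ih =>
    intro a b
    obtain ⟨c, hc⟩ : ∃ c, 0 < substMatrix ρ a c := by
      by_contra! h
      have h0 := hpos a a
      obtain ⟨K, rfl⟩ := Nat.exists_eq_succ_of_ne_zero hK.ne'
      rw [Nat.succ_eq_add_one, pow_succ', Matrix.mul_apply] at h0
      simp [fun c => le_antisymm (h c) (hnonneg a c)] at h0
    rw [pow_succ', Matrix.mul_apply]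
    exact Finset.sum_pos' (fun d _ => mul_nonneg (hnonneg a d) (ih d b).le)
      ⟨c, Finset.mem_univ c, mul_pos hc (ih c b)⟩

theorem exists_mem_positions_superword (hρ : IsPrimitiveInflation ρ lam ℓ) :
    ∃ K, ∀ r, K ≤ r → ∀ a b, ∃ u, u ∈ positions ℓ (superword ρ r b) a := by
  obtain ⟨K, hK⟩ := hρ.exists_forall_pow_pos
  refine ⟨K, fun r hr a b => ?_⟩
  have h := hK r hr a b
  rw [← count_superword, ← card_positions hρ.length_pos, Nat.cast_pos, Finset.card_pos] at h
  exact h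

theorem add_mem_positions_superword (hρ : IsPrimitiveInflation ρ lam ℓ) {r : ℕ} {a b : A} {u : ℝ}
    (hu : u ∈ positions ℓ (superword ρ r b) a) (k : ℕ) {i : A} {x : ℝ}
    (hx : x ∈ positions ℓ (superword ρ k a) i) :
    lam ^ k * u + x ∈ positions ℓ (superword ρ (k + r) b) i := by
  induction k generalizing i x with
  | zero =>
    obtain ⟨rfl, rfl⟩ : a = i ∧ x = 0 := by
      simpa [superword, mem_positions_cons, show positions ℓ [] i = ∅ from rfl] using hx
    simpa using hu
  | succ k ih =>
    rw [superword_succ, hρ.mem_positions_flatMap] at hx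
    obtain ⟨j, v, hv, y, hy, rfl⟩ := hx
    rw [Nat.add_right_comm, superword_succ, hρ.mem_positions_flatMap]
    exact ⟨j, _, ih hv, y, hy, by ring⟩

theorem add_mem_iterate_inflate (hρ : IsPrimitiveInflation ρ lam ℓ) {T : A → Set ℝ} {b : A}
    {u : ℝ} (hu : u ∈ T b) (k : ℕ) {i : A} {x : ℝ} (hx : x ∈ positions ℓ (superword ρ k b) i) :
    lam ^ k * u + x ∈ (inflate ρ lam ℓ)^[k] T i := by
  induction k generalizing i x with
  | zero =>
    obtain ⟨rfl, rfl⟩ : b = i ∧ x = 0 := by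
      simpa [superword, mem_positions_cons, show positions ℓ [] i = ∅ from rfl] using hx
    simpa using hu
  | succ k ih =>
    rw [superword_succ, hρ.mem_positions_flatMap] at hx
    obtain ⟨j, v, hv, y, hy, rfl⟩ := hx
    rw [Function.iterate_succ_apply']
    exact ⟨j, _, ih hv, y, by rwa [displacement_eq_positions], by ring⟩

/-- Repetitivity: every distance within a supertile recurs in `T` with bounded gaps. -/
theorem IsFixedPointTiling.exists_relatively_dense (hρ : IsPrimitiveInflation ρ lam ℓ)
    {T : A → Set ℝ} (hT : IsFixedPointTiling ρ lam ℓ T) {i j : A} {z : ℝ}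
    (hz : z ∈ superDist ρ ℓ i j) :
    ∃ G, 0 ≤ G ∧ ∀ c : ℝ, ∃ w ∈ T i, |w - c| ≤ G ∧ w + z ∈ T j := by
  obtain ⟨k, a, p, hp, hpz⟩ := hz
  obtain ⟨K, hK⟩ := exists_mem_positions_superword hρ
  obtain ⟨q, hq, hfix⟩ := hT.fixed
  -- The total level is a multiple of `q`, so that it fixes `T`, while `r` is large enough for every
  -- level-`r` supertile to contain a tile of type `a`.
  obtain ⟨r, hr, hN⟩ : ∃ r, K ≤ r ∧ k + r = q * (k + K) := by
    have : k + K ≤ q * (k + K) := Nat.le_mul_of_pos_left _ hq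
    exact ⟨q * (k + K) - k, by omega, by omega⟩
  have hfixN : (inflate ρ lam ℓ)^[k + r] T = T := by
    rw [hN, Function.iterate_mul]
    exact Function.iterate_fixed hfix _
  choose u hu using fun b => hK r hr a b
  have hpow : 0 < lam ^ (k + r) := pow_pos hρ.lam_pos _
  have hℓ := hρ.length_pos
  -- The first term bounds the distance from `c` to the start of the supertile covering it, the
  -- second the offset inside that supertile.
  refine ⟨lam ^ (k + r) * ∑ b, ℓ b + ∑ b, |lam ^ k * u b + p|, ?_, fun c => ?_⟩
  · exact add_nonneg (mul_nonneg hpow.le (Finset.sum_nonneg fun b _ => (hℓ b).le))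
      (Finset.sum_nonneg fun b _ => abs_nonneg _)
  obtain ⟨⟨v, b⟩, ⟨hv, hvc⟩, -⟩ := hT.tiling (c / lam ^ (k + r))
  have mem : ∀ {m : A} {x : ℝ}, x ∈ positions ℓ (superword ρ k a) m →
      lam ^ (k + r) * v + (lam ^ k * u b + x) ∈ T m := fun {m x} hx => by
    rw [← hfixN]
    exact add_mem_iterate_inflate hρ hv _ (add_mem_positions_superword hρ (hu b) k hx)
  refine ⟨_, mem hp, ?_, ?_⟩
  · have h1 : |lam ^ (k + r) * v - c| ≤ lam ^ (k + r) * ∑ b, ℓ b := by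
      have hc : c = lam ^ (k + r) * (c / lam ^ (k + r)) := (mul_div_cancel₀ _ hpow.ne').symm
      rw [hc, ← mul_sub, abs_mul, abs_of_pos hpow]
      refine mul_le_mul_of_nonneg_left ?_ hpow.le
      have := Finset.single_le_sum (f := ℓ) (fun b _ => (hℓ b).le) (Finset.mem_univ b)
      have h2 := hvc.1
      have h3 := hvc.2
      simp only at h2 h3
      rw [abs_le]
      constructor <;> linarith
    have h2 := Finset.single_le_sum (f := fun b => |lam ^ k * u b + p|)
      (fun b _ => abs_nonneg _) (Finset.mem_univ b)
    calc |lam ^ (k + r) * v + (lam ^ k * u b + p) - c|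
        = |(lam ^ (k + r) * v - c) + (lam ^ k * u b + p)| := by ring_nf
      _ ≤ _ := (abs_add_le _ _).trans (add_le_add h1 h2)
  · have := mem hpz
    rwa [← add_assoc, ← add_assoc, add_assoc _ _ p] at this

theorem distSet_eq_superDist (hρ : IsPrimitiveInflation ρ lam ℓ) {T : A → Set ℝ}
    (hT : IsFixedPointTiling ρ lam ℓ T) {Λ : A → Set ℝ} (hΛ : Λ ∈ hull T) :
    distSet Λ = superDist ρ ℓ := by
  ext i j z
  constructor
  · rintro ⟨q, hq, p, hp, rfl⟩
    -- The extra 1 leaves room for the small translation `s`.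
    have hB : 1 ≤ |p| + |q| + 1 := by linarith [abs_nonneg p, abs_nonneg q]
    obtain ⟨t, s, hs, hst⟩ := hΛ (1 / (|p| + |q| + 1)) (by positivity)
    rw [one_div_one_div] at hst
    have hs1 : |s| ≤ 1 := hs.trans ((div_le_one (by linarith)).2 hB)
    have key : ∀ {m : A} {x : ℝ}, x ∈ Λ m → |x| ≤ |p| + |q| → ∃ y ∈ T m, t + y = s + x := by
      intro m x hx hxB
      have : s + x ∈ shift s Λ m ∩ Set.Icc (-(|p| + |q| + 1)) (|p| + |q| + 1) :=
        ⟨⟨x, hx, rfl⟩, abs_le.1 ((abs_add_le _ _).trans (by linarith))⟩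
      rw [hst m] at this
      exact this.1
    obtain ⟨p', hp', hpe⟩ := key hp (by linarith [abs_nonneg q])
    obtain ⟨q', hq', hqe⟩ := key hq (by linarith [abs_nonneg p])
    obtain ⟨k, a, t', ht'⟩ := hT.legal (|p'| + |q'|)
    obtain ⟨x, hx, hxe⟩ := ht' i ⟨hp', abs_le.1 (by linarith [abs_nonneg q'])⟩
    obtain ⟨y, hy, hye⟩ := ht' j ⟨hq', abs_le.1 (by linarith [abs_nonneg p'])⟩
    rw [supertile_eq_positions hρ] at hx hy
    simp only at hxe hye
    refine ⟨k, a, x, hx, ?_⟩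
    have : x + (q - p) = y := by linarith
    simpa [this] using hy
  · intro hz
    obtain ⟨G, hG, h⟩ := hT.exists_relatively_dense hρ hz
    have hB : 0 < G + |z| + 1 := by positivity
    obtain ⟨t, s, -, hst⟩ := hΛ (1 / (G + |z| + 1)) (by positivity)
    rw [one_div_one_div] at hst
    -- Centring at `-t` puts both tiles of the pair, once shifted by `t`, into the window of
    -- agreement.
    obtain ⟨w, hw, hwG, hwz⟩ := h (-t)
    have key : ∀ {m : A} {y : ℝ}, y ∈ T m → |t + y| ≤ G + |z| + 1 → ∃ x ∈ Λ m, s + x = t + y := by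
      intro m y hy hyB
      have : t + y ∈ shift t T m ∩ Set.Icc (-(G + |z| + 1)) (G + |z| + 1) :=
        ⟨⟨y, hy, rfl⟩, abs_le.1 hyB⟩
      rw [← hst m] at this
      exact this.1
    rw [sub_neg_eq_add, add_comm] at hwG
    obtain ⟨p, hp, hpe⟩ := key hw (by linarith [abs_nonneg z])
    obtain ⟨q, hq, hqe⟩ := key hwz (by
      rw [← add_assoc]
      exact (abs_add_le _ _).trans (by linarith))
    exact ⟨q, hq, p, hp, by simp only; linarith⟩

end Geometry

/-! ### Perron theory for the substitution matrix -/

section Perron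

variable {A : Type*} [Fintype A] [DecidableEq A] {ρ : A → List A} {lam : ℝ} {ℓ : A → ℝ}

/-- The triangle inequality gives `≥` in each row; pairing with the positive left eigenvector makes
the sums agree, so each row is an equality. -/
theorem abs_eigenvector (hρ : IsPrimitiveInflation ρ lam ℓ) {u : A → ℝ}
    (hu : ∀ i, ∑ j, substMatrix ρ i j * u j = lam * u i) (i : A) :
    ∑ j, substMatrix ρ i j * |u j| = lam * |u i| := by
  have hle : ∀ i ∈ Finset.univ, ℓ i * (lam * |u i|) ≤ ℓ i * ∑ j, substMatrix ρ i j * |u j| := by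
    intro i _
    refine mul_le_mul_of_nonneg_left ?_ (hρ.length_pos i).le
    rw [show lam * |u i| = |lam * u i| by rw [abs_mul, abs_of_pos hρ.lam_pos], ← hu i]
    refine (Finset.abs_sum_le_sum_abs _ _).trans_eq (Finset.sum_congr rfl fun j _ => ?_)
    rw [abs_mul, abs_of_nonneg (hρ.primitive.nonneg i j)]
  have hsum : ∑ i, ℓ i * (lam * |u i|) = ∑ i, ℓ i * ∑ j, substMatrix ρ i j * |u j| := by
    simp only [Finset.mul_sum]
    rw [Finset.sum_comm]
    refine Finset.sum_congr rfl fun j _ => ?_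
    have h := congrFun hρ.eigenvector j
    simp only [Matrix.vecMul, dotProduct, Pi.smul_apply, smul_eq_mul] at h
    rw [← mul_assoc, mul_comm (ℓ j), ← h, Finset.sum_mul]
    exact Finset.sum_congr rfl fun i _ => mul_assoc _ _ _
  have := (Finset.sum_eq_sum_iff_of_le hle).1 hsum i (Finset.mem_univ i)
  exact (mul_left_cancel₀ (hρ.length_pos i).ne' this).symm

theorem pow_eigenvector {u : A → ℝ} (hu : ∀ i, ∑ j, substMatrix ρ i j * u j = lam * u i) (k : ℕ)
    (i : A) : ∑ j, (substMatrix ρ ^ k) i j * u j = lam ^ k * u i := by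
  induction k generalizing i with
  | zero => simp [Matrix.one_apply]
  | succ k ih =>
    simp only [pow_succ', Matrix.mul_apply, Finset.sum_mul, mul_assoc]
    rw [Finset.sum_comm]
    simp only [← Finset.mul_sum, ih]
    simp only [mul_left_comm _ (lam ^ k), ← Finset.mul_sum, hu]

theorem eigenvector_ne_zero (hρ : IsPrimitiveInflation ρ lam ℓ) {u : A → ℝ}
    (hu : ∀ i, ∑ j, substMatrix ρ i j * u j = lam * u i) (h0 : u ≠ 0) (i : A) : u i ≠ 0 := by
  obtain ⟨a, ha⟩ := Function.ne_iff.1 h0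
  obtain ⟨K, hK⟩ := hρ.exists_forall_pow_pos
  have h := pow_eigenvector (abs_eigenvector hρ hu) K i
  have hpos : 0 < ∑ j, (substMatrix ρ ^ K) i j * |u j| :=
    Finset.sum_pos' (fun j _ => mul_nonneg (hK K le_rfl i j).le (abs_nonneg _))
      ⟨a, Finset.mem_univ a, mul_pos (hK K le_rfl i a) (abs_pos.2 ha)⟩
  rw [h] at hpos
  exact abs_pos.1 (pos_of_mul_pos_right hpos (pow_pos hρ.lam_pos K).le)

/-- Perron's theorem: existence of a positive right eigenvector. -/
theorem exists_pos_eigenvector [Nonempty A] (hρ : IsPrimitiveInflation ρ lam ℓ) :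
    ∃ v : A → ℝ, (∀ i, 0 < v i) ∧ (∀ i, ∑ j, substMatrix ρ i j * v j = lam * v i) ∧
      ∑ i, v i = 1 := by
  obtain ⟨u, hu0, hu⟩ : ∃ u : A → ℝ, u ≠ 0 ∧ ∀ i, ∑ j, substMatrix ρ i j * u j = lam * u i := by
    have hdet : (substMatrix ρ - lam • (1 : Matrix A A ℝ)).det = 0 := by
      refine Matrix.exists_vecMul_eq_zero_iff.1 ⟨ℓ, fun h => ?_, ?_⟩
      · obtain ⟨a⟩ := ‹Nonempty A›
        exact (hρ.length_pos a).ne' (congrFun h a)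
      · rw [Matrix.vecMul_sub, hρ.eigenvector, Matrix.vecMul_smul, Matrix.vecMul_one, sub_self]
    obtain ⟨u, hu0, hu⟩ := Matrix.exists_mulVec_eq_zero_iff.2 hdet
    refine ⟨u, hu0, fun i => ?_⟩
    rw [Matrix.sub_mulVec, Matrix.smul_mulVec, Matrix.one_mulVec, sub_eq_zero] at hu
    exact congrFun hu i
  have hpos : ∀ i, 0 < |u i| := fun i => abs_pos.2 (eigenvector_ne_zero hρ hu hu0 i)
  have hs : 0 < ∑ i, |u i| := Finset.sum_pos (fun i _ => hpos i) Finset.univ_nonempty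
  refine ⟨fun i => |u i| / ∑ i, |u i|, fun i => div_pos (hpos i) hs, fun i => ?_, ?_⟩
  · simp only [← mul_div_assoc, ← Finset.sum_div, abs_eigenvector hρ hu]
  · rw [← Finset.sum_div, div_self hs.ne']

/-- Perron's theorem: the eigenspace is one-dimensional. -/
theorem eigenvector_unique [Nonempty A] (hρ : IsPrimitiveInflation ρ lam ℓ) {u v : A → ℝ}
    (hv : ∀ i, 0 < v i) (hvM : ∀ i, ∑ j, substMatrix ρ i j * v j = lam * v i)
    (hu : ∀ i, ∑ j, substMatrix ρ i j * u j = lam * u i) : ∃ t : ℝ, ∀ i, u i = t * v i := by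
  obtain ⟨a⟩ := ‹Nonempty A›
  refine ⟨u a / v a, fun i => ?_⟩
  by_contra h
  -- This combination vanishes at `a`, whereas a nonzero eigenvector has no zero entry.
  refine eigenvector_ne_zero hρ (u := fun i => u i - u a / v a * v i) (fun i => ?_)
    (fun h0 => h (sub_eq_zero.1 (congrFun h0 i))) a ?_
  · simp only [mul_sub, Finset.sum_sub_distrib, hu, mul_left_comm _ (u a / v a), ← Finset.mul_sum,
      hvM]
  · simp [(hv a).ne']

end Perron

/-! ### Pair counts in supertiles and their limiting frequencies -/

section Counting

variable {A : Type*} [DecidableEq A]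

/-- The number of pairs of tiles of types `m` and `n` at distance `z` in the patch of `w`. -/
noncomputable def pairCount (ℓ : A → ℝ) (w : List A) (m n : A) (z : ℝ) : ℝ :=
  ∑ p ∈ positions ℓ w m, ∑ q ∈ positions ℓ w n, if q = p + z then 1 else 0

theorem pairCount_eq (ℓ : A → ℝ) (w : List A) (m n : A) (z : ℝ) :
    pairCount ℓ w m n z =
      ∑ p ∈ positions ℓ w m, if p + z ∈ positions ℓ w n then (1 : ℝ) else 0 := by
  simp [pairCount]

theorem pairCount_nonneg (ℓ : A → ℝ) (w : List A) (m n : A) (z : ℝ) :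
    0 ≤ pairCount ℓ w m n z :=
  Finset.sum_nonneg fun _ _ => Finset.sum_nonneg fun _ _ => by split_ifs <;> norm_num

theorem pairCount_pos_iff {ℓ : A → ℝ} {w : List A} {m n : A} {z : ℝ} :
    0 < pairCount ℓ w m n z ↔ ∃ p ∈ positions ℓ w m, p + z ∈ positions ℓ w n := by
  rw [pairCount_eq, Finset.sum_pos_iff_of_nonneg fun _ _ => by split_ifs <;> norm_num]
  refine exists_congr fun p => and_congr_right fun _ => ?_
  split_ifs with h <;> simp [h]

theorem pairCount_le {ℓ : A → ℝ} (hℓ : ∀ i, 0 < ℓ i) (w : List A) (m n : A) (z : ℝ) :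
    pairCount ℓ w m n z ≤ w.count m := by
  rw [pairCount_eq, ← card_positions hℓ, Finset.cast_card]
  exact Finset.sum_le_sum fun _ _ => by split_ifs <;> norm_num

theorem pairCount_self_zero {ℓ : A → ℝ} (hℓ : ∀ i, 0 < ℓ i) (w : List A) (m : A) :
    pairCount ℓ w m m 0 = w.count m := by
  rw [pairCount_eq, ← card_positions hℓ, Finset.cast_card]
  exact Finset.sum_congr rfl fun p hp => by simp [hp]

variable [Fintype A] {ρ : A → List A} {lam : ℝ} {ℓ : A → ℝ}

/-- Grouping tiles by parent supertile and offset turns distance `z` into parent distance `(z + x -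
y) / lam`; this is the combinatorial source of (RE). -/
theorem pairCount_flatMap (hρ : IsPrimitiveInflation ρ lam ℓ) (w : List A) (m n : A) (z : ℝ) :
    pairCount ℓ (w.flatMap ρ) m n z =
      ∑ i, ∑ j, ∑ x ∈ positions ℓ (ρ i) m, ∑ y ∈ positions ℓ (ρ j) n,
        pairCount ℓ w i j ((z + x - y) / lam) := by
  simp only [pairCount, hρ.sum_positions_flatMap]
  refine Finset.sum_congr rfl fun i _ => ?_
  rw [Finset.sum_congr rfl fun u _ => Finset.sum_comm, Finset.sum_comm]
  refine Finset.sum_congr rfl fun j _ => ?_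
  rw [Finset.sum_comm]
  refine Finset.sum_congr rfl fun x _ => ?_
  rw [Finset.sum_congr rfl fun u _ => Finset.sum_comm, Finset.sum_comm]
  refine Finset.sum_congr rfl fun y _ => Finset.sum_congr rfl fun u _ =>
    Finset.sum_congr rfl fun u' _ => if_congr ?_ rfl rfl
  rw [← sub_eq_iff_eq_add' (a := u'), eq_div_iff hρ.lam_pos.ne']
  constructor <;> intro h <;> linarith

/-- The right-hand side of the renormalisation equations. -/
noncomputable def renorm (ρ : A → List A) (lam : ℝ) (ℓ : A → ℝ) (ν : A → A → ℝ → ℝ) (m n : A)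
    (z : ℝ) : ℝ :=
  1 / lam * ∑ i, ∑ j, ∑ x ∈ positions ℓ (ρ i) m, ∑ y ∈ positions ℓ (ρ j) n,
    ν i j ((z + x - y) / lam)

theorem satisfiesRE_iff {ν : A → A → ℝ → ℝ} :
    SatisfiesRE ρ lam ℓ ν ↔ ∀ m n z, ν m n z = renorm ρ lam ℓ ν m n z := by
  simp only [SatisfiesRE, renorm, displacement_eq_positions]

theorem renorm_le_renorm (hlam : 0 < lam) {μ ν : A → A → ℝ → ℝ} {m n : A} {z : ℝ}
    (h : ∀ i j, ∀ x ∈ positions ℓ (ρ i) m, ∀ y ∈ positions ℓ (ρ j) n,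
      μ i j ((z + x - y) / lam) ≤ ν i j ((z + x - y) / lam)) :
    renorm ρ lam ℓ μ m n z ≤ renorm ρ lam ℓ ν m n z :=
  mul_le_mul_of_nonneg_left (Finset.sum_le_sum fun i _ => Finset.sum_le_sum fun j _ =>
    Finset.sum_le_sum fun x hx => Finset.sum_le_sum fun y hy => h i j x hx y hy)
    (one_div_nonneg.2 hlam.le)

theorem abs_renorm_le (hlam : 0 < lam) (ν : A → A → ℝ → ℝ) (m n : A) (z : ℝ) :
    |renorm ρ lam ℓ ν m n z| ≤ renorm ρ lam ℓ (fun i j z => |ν i j z|) m n z := by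
  rw [renorm, abs_mul, abs_of_nonneg (one_div_nonneg.2 hlam.le)]
  refine mul_le_mul_of_nonneg_left ?_ (one_div_nonneg.2 hlam.le)
  refine (Finset.abs_sum_le_sum_abs _ _).trans (Finset.sum_le_sum fun i _ => ?_)
  refine (Finset.abs_sum_le_sum_abs _ _).trans (Finset.sum_le_sum fun j _ => ?_)
  refine (Finset.abs_sum_le_sum_abs _ _).trans (Finset.sum_le_sum fun x _ => ?_)
  exact Finset.abs_sum_le_sum_abs _ _

theorem renorm_smul_sub (c : ℝ) (μ ν : A → A → ℝ → ℝ) (m n : A) (z : ℝ) :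
    renorm ρ lam ℓ (fun i j z => c * (μ i j z - ν i j z)) m n z =
      c * (renorm ρ lam ℓ μ m n z - renorm ρ lam ℓ ν m n z) := by
  simp only [renorm, ← Finset.mul_sum, Finset.sum_sub_distrib]
  ring

/-- Distances in `ρ ^ k (a)`, counted with weights `v a` and scaled by `lam ^ k`. -/
noncomputable def approxFreq (ρ : A → List A) (lam : ℝ) (ℓ v : A → ℝ) (k : ℕ) (m n : A)
    (z : ℝ) : ℝ :=
  (∑ a, v a * pairCount ℓ (superword ρ k a) m n z) / lam ^ k

theorem approxFreq_nonneg (hlam : 0 < lam) {v : A → ℝ} (hv : ∀ a, 0 < v a) (k : ℕ) (m n : A)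
    (z : ℝ) : 0 ≤ approxFreq ρ lam ℓ v k m n z :=
  div_nonneg (Finset.sum_nonneg fun a _ => mul_nonneg (hv a).le (pairCount_nonneg _ _ _ _ _))
    (pow_pos hlam k).le

theorem approxFreq_succ (hρ : IsPrimitiveInflation ρ lam ℓ) (v : A → ℝ) (k : ℕ) (m n : A)
    (z : ℝ) : approxFreq ρ lam ℓ v (k + 1) m n z =
      renorm ρ lam ℓ (approxFreq ρ lam ℓ v k) m n z := by
  simp only [approxFreq, renorm, superword_succ, pairCount_flatMap hρ, ← Finset.sum_div]
  rw [pow_succ, one_div_mul_eq_div, div_div]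
  congr 1
  simp only [Finset.mul_sum]
  rw [Finset.sum_comm]
  refine Finset.sum_congr rfl fun i _ => ?_
  rw [Finset.sum_comm]
  refine Finset.sum_congr rfl fun j _ => ?_
  rw [Finset.sum_comm]
  refine Finset.sum_congr rfl fun x _ => ?_
  rw [Finset.sum_comm]

theorem sum_count_superword_div (hρ : IsPrimitiveInflation ρ lam ℓ) {v : A → ℝ}
    (hv : ∀ i, ∑ j, substMatrix ρ i j * v j = lam * v i) (k : ℕ) (m : A) :
    (∑ a, v a * ((superword ρ k a).count m : ℝ)) / lam ^ k = v m := by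
  simp only [count_superword, mul_comm (v _)]
  rw [pow_eigenvector hv, mul_div_cancel_left₀ _ (pow_pos hρ.lam_pos k).ne']

theorem approxFreq_self_zero (hρ : IsPrimitiveInflation ρ lam ℓ) {v : A → ℝ}
    (hv : ∀ i, ∑ j, substMatrix ρ i j * v j = lam * v i) (k : ℕ) (m : A) :
    approxFreq ρ lam ℓ v k m m 0 = v m := by
  simp only [approxFreq, pairCount_self_zero hρ.length_pos, sum_count_superword_div hρ hv]

theorem approxFreq_le (hρ : IsPrimitiveInflation ρ lam ℓ) {v : A → ℝ} (hpos : ∀ i, 0 < v i)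
    (hv : ∀ i, ∑ j, substMatrix ρ i j * v j = lam * v i) (k : ℕ) (m n : A) (z : ℝ) :
    approxFreq ρ lam ℓ v k m n z ≤ v m := by
  refine le_of_le_of_eq ?_ (sum_count_superword_div hρ hv k m)
  exact div_le_div_of_nonneg_right (Finset.sum_le_sum fun a _ =>
    mul_le_mul_of_nonneg_left (pairCount_le hρ.length_pos _ _ _ _) (hpos a).le)
    (pow_pos hρ.lam_pos k).le

theorem approxFreq_zero_of_ne {v : A → ℝ} {m n : A} {z : ℝ} (h : m = n → z ≠ 0) :
    approxFreq ρ lam ℓ v 0 m n z = 0 := by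
  simp only [approxFreq, pow_zero, div_one]
  refine Finset.sum_eq_zero fun a _ => mul_eq_zero_of_right _ ?_
  by_contra hne
  obtain ⟨p, hp, hq⟩ := pairCount_pos_iff.1 ((pairCount_nonneg _ _ _ _ _).lt_of_ne' hne)
  simp only [superword, Function.iterate_zero, id, mem_positions_cons,
    show ∀ i, positions ℓ [] i = ∅ from fun _ => rfl, Finset.notMem_empty, false_and,
    exists_false, or_false] at hp hq
  exact h (hp.1.symm.trans hq.1) (by linarith [hp.2, hq.2])

/-- `renorm` preserves order, so only the first step matters: level 0 is zero off the diagonal pairs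
at `z = 0`, and there the value is `v m` at every level. -/
theorem approxFreq_monotone (hρ : IsPrimitiveInflation ρ lam ℓ) {v : A → ℝ}
    (hpos : ∀ i, 0 < v i) (hv : ∀ i, ∑ j, substMatrix ρ i j * v j = lam * v i) (m n : A) (z : ℝ) :
    Monotone fun k => approxFreq ρ lam ℓ v k m n z := by
  refine monotone_nat_of_le_succ fun k => ?_
  induction k generalizing m n z with
  | zero =>
    by_cases h : m = n → z ≠ 0
    · rw [approxFreq_zero_of_ne h]
      exact approxFreq_nonneg hρ.lam_pos hpos _ _ _ _
    · push Not at h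
      obtain ⟨rfl, rfl⟩ := h
      simp only [approxFreq_self_zero hρ hv, le_refl]
  | succ k ih =>
    rw [approxFreq_succ hρ v (k + 1), approxFreq_succ hρ v k]
    exact renorm_le_renorm hρ.lam_pos fun i j x _ y _ => ih i j _

/-- The relative frequency of tiles of types `m` and `n` at distance `z`. -/
noncomputable def pairFreq (ρ : A → List A) (lam : ℝ) (ℓ v : A → ℝ) (m n : A) (z : ℝ) : ℝ :=
  ⨆ k, approxFreq ρ lam ℓ v k m n z

theorem approxFreq_bddAbove (hρ : IsPrimitiveInflation ρ lam ℓ) {v : A → ℝ}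
    (hpos : ∀ i, 0 < v i) (hv : ∀ i, ∑ j, substMatrix ρ i j * v j = lam * v i) (m n : A) (z : ℝ) :
    BddAbove (Set.range fun k => approxFreq ρ lam ℓ v k m n z) :=
  ⟨v m, by rintro _ ⟨k, rfl⟩; exact approxFreq_le hρ hpos hv k m n z⟩

theorem approxFreq_le_pairFreq (hρ : IsPrimitiveInflation ρ lam ℓ) {v : A → ℝ}
    (hpos : ∀ i, 0 < v i) (hv : ∀ i, ∑ j, substMatrix ρ i j * v j = lam * v i) (k : ℕ) (m n : A)
    (z : ℝ) : approxFreq ρ lam ℓ v k m n z ≤ pairFreq ρ lam ℓ v m n z :=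
  le_ciSup (approxFreq_bddAbove hρ hpos hv m n z) k

theorem tendsto_approxFreq (hρ : IsPrimitiveInflation ρ lam ℓ) {v : A → ℝ}
    (hpos : ∀ i, 0 < v i) (hv : ∀ i, ∑ j, substMatrix ρ i j * v j = lam * v i) (m n : A) (z : ℝ) :
    Filter.Tendsto (fun k => approxFreq ρ lam ℓ v k m n z) Filter.atTop
      (nhds (pairFreq ρ lam ℓ v m n z)) :=
  tendsto_atTop_ciSup (approxFreq_monotone hρ hpos hv m n z) (approxFreq_bddAbove hρ hpos hv m n z)

theorem pairFreq_eq_renorm (hρ : IsPrimitiveInflation ρ lam ℓ) {v : A → ℝ}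
    (hpos : ∀ i, 0 < v i) (hv : ∀ i, ∑ j, substMatrix ρ i j * v j = lam * v i) (m n : A) (z : ℝ) :
    pairFreq ρ lam ℓ v m n z = renorm ρ lam ℓ (pairFreq ρ lam ℓ v) m n z := by
  refine tendsto_nhds_unique
    ((tendsto_approxFreq hρ hpos hv m n z).comp (Filter.tendsto_add_atTop_nat 1)) ?_
  simp only [Function.comp_def, approxFreq_succ hρ]
  refine Filter.Tendsto.const_mul _ ?_
  exact tendsto_finsetSum _ fun i _ => tendsto_finsetSum _ fun j _ => tendsto_finsetSum _ fun x _ =>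
    tendsto_finsetSum _ fun y _ => tendsto_approxFreq hρ hpos hv i j _

theorem pairFreq_self_zero (hρ : IsPrimitiveInflation ρ lam ℓ) {v : A → ℝ}
    (hv : ∀ i, ∑ j, substMatrix ρ i j * v j = lam * v i) (m : A) :
    pairFreq ρ lam ℓ v m m 0 = v m := by
  simp only [pairFreq, approxFreq_self_zero hρ hv, ciSup_const]

theorem pairFreq_pos (hρ : IsPrimitiveInflation ρ lam ℓ) {v : A → ℝ} (hpos : ∀ i, 0 < v i)
    (hv : ∀ i, ∑ j, substMatrix ρ i j * v j = lam * v i) {m n : A} {z : ℝ}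
    (hz : z ∈ superDist ρ ℓ m n) : 0 < pairFreq ρ lam ℓ v m n z := by
  obtain ⟨k, a, h⟩ := hz
  refine lt_of_lt_of_le ?_ (approxFreq_le_pairFreq hρ hpos hv k m n z)
  refine div_pos (Finset.sum_pos' (fun b _ => ?_) ⟨a, Finset.mem_univ a, ?_⟩)
    (pow_pos hρ.lam_pos k)
  · exact mul_nonneg (hpos b).le (pairCount_nonneg _ _ _ _ _)
  · exact mul_pos (hpos a) (pairCount_pos_iff.2 h)

theorem pairFreq_eq_zero {v : A → ℝ} {m n : A} {z : ℝ} (hz : z ∉ superDist ρ ℓ m n) :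
    pairFreq ρ lam ℓ v m n z = 0 := by
  have h : ∀ k, approxFreq ρ lam ℓ v k m n z = 0 := fun k => by
    refine div_eq_zero_iff.2 (Or.inl (Finset.sum_eq_zero fun a _ => mul_eq_zero_of_right _ ?_))
    by_contra hne
    exact hz ⟨k, a, pairCount_pos_iff.1 ((pairCount_nonneg _ _ _ _ _).lt_of_ne' hne)⟩
  simp only [pairFreq, h, ciSup_const]

theorem pairFreq_mem (hρ : IsPrimitiveInflation ρ lam ℓ) {v : A → ℝ} (hpos : ∀ i, 0 < v i)
    (hv : ∀ i, ∑ j, substMatrix ρ i j * v j = lam * v i) :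
    pairFreq ρ lam ℓ v ∈ solutionSpace ρ lam ℓ (superDist ρ ℓ) :=
  ⟨fun _ _ _ hz => by_contra fun h => hz (pairFreq_eq_zero h),
    satisfiesRE_iff.2 (pairFreq_eq_renorm hρ hpos hv)⟩

end Counting

/-! ### Contraction and uniqueness of solutions -/

section Solutions

variable {A : Type*} [DecidableEq A] [Fintype A] {ρ : A → List A} {lam : ℝ} {ℓ : A → ℝ}

/-- The arguments on the right-hand side of the renormalisation equations are contracted. -/
theorem exists_contraction (hρ : IsPrimitiveInflation ρ lam ℓ) :
    ∃ R₀, 0 ≤ R₀ ∧ ∀ r, 0 ≤ r → ∀ z, |z| ≤ R₀ + lam * r → ∀ i j m n,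
      ∀ x ∈ positions ℓ (ρ i) m, ∀ y ∈ positions ℓ (ρ j) n, |(z + x - y) / lam| ≤ R₀ + r := by
  have hL : ∀ i, 0 ≤ wordLength ℓ (ρ i) := fun i => wordLength_nonneg hρ.length_pos _
  have hlam : 0 < lam - 1 := sub_pos.2 hρ.one_lt
  -- With `C` the sum of the supertile lengths, which bounds `|x - y|`, this is the fixed point of
  -- `R ↦ (R + C) / lam`.
  refine ⟨(∑ i, wordLength ℓ (ρ i)) / (lam - 1),
    div_nonneg (Finset.sum_nonneg fun i _ => hL i) hlam.le, ?_⟩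
  intro r _ z hz i j m n x hx y hy
  have hx' := positions_bounds hρ.length_pos hx
  have hy' := positions_bounds hρ.length_pos hy
  have hi := Finset.single_le_sum (fun i _ => hL i) (Finset.mem_univ i)
  have hj := Finset.single_le_sum (fun i _ => hL i) (Finset.mem_univ j)
  have hm := hρ.length_pos m
  have hn := hρ.length_pos n
  rw [abs_div, abs_of_pos hρ.lam_pos, div_le_iff₀ hρ.lam_pos]
  set C := ∑ i, wordLength ℓ (ρ i)
  have hC : C / (lam - 1) * lam = C / (lam - 1) + C := by
    field_simp
    ring
  rw [add_mul, hC]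
  rw [abs_le] at hz ⊢
  constructor <;> linarith

theorem eq_zero_of_eq_zero_on_window (hρ : IsPrimitiveInflation ρ lam ℓ) :
    ∃ R, ∀ ν : A → A → ℝ → ℝ, SatisfiesRE ρ lam ℓ ν → (∀ i j z, |z| ≤ R → ν i j z = 0) →
      ν = 0 := by
  obtain ⟨R₀, -, hR⟩ := exists_contraction hρ
  refine ⟨R₀ + 1, fun ν hν h0 => ?_⟩
  rw [satisfiesRE_iff] at hν
  -- By contraction, the zero window widens at each step until it exhausts the line.
  have key : ∀ k : ℕ, ∀ i j z, |z| ≤ R₀ + lam ^ k → ν i j z = 0 := by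
    intro k
    induction k with
    | zero => simpa using h0
    | succ k ih =>
      intro m n z hz
      rw [pow_succ'] at hz
      rw [hν, renorm]
      refine mul_eq_zero_of_right _ (Finset.sum_eq_zero fun i _ => Finset.sum_eq_zero fun j _ =>
        Finset.sum_eq_zero fun x hx => Finset.sum_eq_zero fun y hy => ih i j _ ?_)
      exact hR _ (pow_pos hρ.lam_pos k).le z hz i j m n x hx y hy
  ext i j z
  obtain ⟨k, hk⟩ := pow_unbounded_of_one_lt (|z| - R₀) hρ.one_lt
  exact key k i j z (by linarith)

theorem finiteDimensional_solutionSpace (hρ : IsPrimitiveInflation ρ lam ℓ)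
    {Δ : A → A → Set ℝ} (hΔ : IsLocallyFinite (⋃ i, ⋃ j, Δ i j)) :
    FiniteDimensional ℝ (solutionSpace ρ lam ℓ Δ) := by
  obtain ⟨R, hR⟩ := eq_zero_of_eq_zero_on_window hρ
  set F := (⋃ i, ⋃ j, Δ i j) ∩ Set.Icc (-R) R
  have hF : Finite F := hΔ _ isCompact_Icc
  let f : (A → A → ℝ → ℝ) →ₗ[ℝ] (A → A → F → ℝ) :=
    { toFun := fun ν i j z => ν i j z
      map_add' := fun _ _ => rfl
      map_smul' := fun _ _ => rfl }
  refine FiniteDimensional.of_injective (f ∘ₗ (solutionSpace ρ lam ℓ Δ).subtype) ?_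
  rw [injective_iff_map_eq_zero]
  rintro ⟨ν, hsupp, hν⟩ h0
  refine Subtype.ext (hR ν hν fun i j z hz => ?_)
  by_contra hne
  have hzF : z ∈ F :=
    ⟨Set.mem_iUnion.2 ⟨i, Set.mem_iUnion.2 ⟨j, hsupp i j hne⟩⟩, abs_le.1 hz⟩
  exact hne (congrFun (congrFun (congrFun h0 i) j) ⟨z, hzF⟩)

/-- The values at `0` of a solution form an eigenvector of the substitution matrix. -/
theorem eigenvector_of_mem_solutionSpace (hρ : IsPrimitiveInflation ρ lam ℓ)
    {ν : A → A → ℝ → ℝ} (hν : ν ∈ solutionSpace ρ lam ℓ (superDist ρ ℓ)) (m : A) :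
    ∑ i, substMatrix ρ m i * ν i i 0 = lam * ν m m 0 := by
  have h := satisfiesRE_iff.1 hν.2 m m 0
  have hzero : ∀ i j, ∀ x ∈ positions ℓ (ρ i) m, ∀ y ∈ positions ℓ (ρ j) m,
      ν i j ((0 + x - y) / lam) = if i = j ∧ x = y then ν i i 0 else 0 := by
    intro i j x hx y hy
    split_ifs with hxy
    · obtain ⟨rfl, rfl⟩ := hxy
      simp
    · by_contra hne
      rw [zero_add] at hne
      exact hxy (eq_of_sub_div_mem_superDist hρ hx hy (hν.1 i j hne))
  rw [h, renorm, ← mul_assoc, mul_one_div_cancel hρ.lam_pos.ne', one_mul]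
  refine Finset.sum_congr rfl fun i _ => ?_
  rw [Finset.sum_congr rfl fun j _ => Finset.sum_congr rfl fun x hx =>
    Finset.sum_congr rfl fun y hy => hzero i j x hx y hy,
    Finset.sum_eq_single_of_mem i (Finset.mem_univ i)]
  · rw [Finset.sum_congr rfl fun x hx => (?_ : _ = ν i i 0)]
    · rw [Finset.sum_const, nsmul_eq_mul, card_positions hρ.length_pos]
      simp [substMatrix]
    · simp [hx]
  · intro j _ hj
    exact Finset.sum_eq_zero fun x _ => Finset.sum_eq_zero fun y _ => if_neg fun h => hj h.1.symm

/-- On bounded sets, every solution is dominated by a multiple of the pair frequencies. -/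
theorem exists_abs_le_mul_pairFreq (hρ : IsPrimitiveInflation ρ lam ℓ) {v : A → ℝ}
    (hpos : ∀ i, 0 < v i) (hv : ∀ i, ∑ j, substMatrix ρ i j * v j = lam * v i)
    {ν : A → A → ℝ → ℝ} (hν : ν ∈ solutionSpace ρ lam ℓ (superDist ρ ℓ)) (R : ℝ) :
    ∃ c, 0 ≤ c ∧ ∀ i j z, |z| ≤ R → |ν i j z| ≤ c * pairFreq ρ lam ℓ v i j z := by
  have hfin := fun i j => superDist_inter_finite (ρ := ρ) hρ.length_pos i j R
  set g : A → A → ℝ → ℝ := fun i j z => |ν i j z| / pairFreq ρ lam ℓ v i j z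
  have hg : ∀ i j, ∀ z ∈ (hfin i j).toFinset, 0 ≤ g i j z := fun i j z hz =>
    div_nonneg (abs_nonneg _) (pairFreq_pos hρ hpos hv ((hfin i j).mem_toFinset.1 hz).1).le
  have hg1 : ∀ i j, 0 ≤ ∑ z ∈ (hfin i j).toFinset, g i j z := fun i j =>
    Finset.sum_nonneg (hg i j)
  have hg2 : ∀ i, 0 ≤ ∑ j, ∑ z ∈ (hfin i j).toFinset, g i j z := fun i =>
    Finset.sum_nonneg fun j _ => hg1 i j
  -- Only finitely many distances lie in the window, so the sum of all the ratios can serve in place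
  -- of their maximum.
  refine ⟨∑ i, ∑ j, ∑ z ∈ (hfin i j).toFinset, g i j z,
    Finset.sum_nonneg fun i _ => hg2 i, fun i j z hz => ?_⟩
  by_cases hS : z ∈ superDist ρ ℓ i j
  · rw [← div_le_iff₀ (pairFreq_pos hρ hpos hv hS)]
    calc g i j z
      _ ≤ ∑ z ∈ (hfin i j).toFinset, g i j z :=
        Finset.single_le_sum (hg i j) ((hfin i j).mem_toFinset.2 ⟨hS, hz⟩)
      _ ≤ ∑ j, ∑ z ∈ (hfin i j).toFinset, g i j z :=
        Finset.single_le_sum (f := fun j => ∑ z ∈ (hfin i j).toFinset, g i j z)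
          (fun j _ => hg1 i j) (Finset.mem_univ j)
      _ ≤ _ := Finset.single_le_sum (f := fun i => ∑ j, ∑ z ∈ (hfin i j).toFinset, g i j z)
          (fun i _ => hg2 i) (Finset.mem_univ i)
  · rw [pairFreq_eq_zero hS, mul_zero, abs_nonpos_iff]
    exact by_contra fun hne => hS (hν.1 i j hne)

/-- A solution is determined by its values at `0`. -/
theorem eq_zero_of_apply_zero (hρ : IsPrimitiveInflation ρ lam ℓ) {v : A → ℝ}
    (hpos : ∀ i, 0 < v i) (hv : ∀ i, ∑ j, substMatrix ρ i j * v j = lam * v i)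
    {ν : A → A → ℝ → ℝ} (hν : ν ∈ solutionSpace ρ lam ℓ (superDist ρ ℓ))
    (h0 : ∀ i, ν i i 0 = 0) : ν = 0 := by
  obtain ⟨R₀, hR₀, hR⟩ := exists_contraction hρ
  have hRE := satisfiesRE_iff.1 hν.2
  ext m n z
  obtain ⟨c, hc, hle⟩ := exists_abs_le_mul_pairFreq hρ hpos hv hν (R₀ + |z|)
  -- The window is mapped into itself by (RE), so one constant `c` serves for all `k`. At `k = 0`
  -- the subtracted term lives only where `ν` vanishes by hypothesis.
  have key : ∀ k : ℕ, ∀ i j y, |y| ≤ R₀ + |z| →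
      |ν i j y| ≤ c * (pairFreq ρ lam ℓ v i j y - approxFreq ρ lam ℓ v k i j y) := by
    intro k
    induction k with
    | zero =>
      intro i j y hy
      by_cases h : i = j → y ≠ 0
      · rw [approxFreq_zero_of_ne h, sub_zero]
        exact hle i j y hy
      · push Not at h
        obtain ⟨rfl, rfl⟩ := h
        rw [h0, abs_zero]
        exact mul_nonneg hc (sub_nonneg.2 (approxFreq_le_pairFreq hρ hpos hv _ _ _ _))
    | succ k ih =>
      intro m n y hy
      rw [hRE, pairFreq_eq_renorm hρ hpos hv, approxFreq_succ hρ, ← renorm_smul_sub]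
      refine (abs_renorm_le hρ.lam_pos _ _ _ _).trans (renorm_le_renorm hρ.lam_pos ?_)
      intro i j x hx x' hx'
      refine ih i j _ (hR _ (abs_nonneg z) y (hy.trans ?_) i j m n x hx x' hx')
      linarith [le_mul_of_one_le_left (abs_nonneg z) hρ.one_lt.le]
  have hlim := ((tendsto_approxFreq hρ hpos hv m n z).const_sub
    (pairFreq ρ lam ℓ v m n z)).const_mul c
  rw [sub_self, mul_zero] at hlim
  exact abs_nonpos_iff.1 (ge_of_tendsto' hlim fun k => key k m n z (by linarith))

theorem exists_eq_smul_pairFreq [Nonempty A] (hρ : IsPrimitiveInflation ρ lam ℓ) {v : A → ℝ}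
    (hpos : ∀ i, 0 < v i) (hv : ∀ i, ∑ j, substMatrix ρ i j * v j = lam * v i)
    {ν : A → A → ℝ → ℝ} (hν : ν ∈ solutionSpace ρ lam ℓ (superDist ρ ℓ)) :
    ∃ t : ℝ, t • pairFreq ρ lam ℓ v = ν := by
  obtain ⟨t, ht⟩ := eigenvector_unique hρ hpos hv (eigenvector_of_mem_solutionSpace hρ hν)
  refine ⟨t, (sub_eq_zero.1 (eq_zero_of_apply_zero hρ hpos hv
    (sub_mem hν (Submodule.smul_mem _ t (pairFreq_mem hρ hpos hv))) fun i => ?_)).symm⟩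
  simp [ht, pairFreq_self_zero hρ hv]

/-- (RE) is invariant under swapping the types and reversing the sign of `z`; the reflected solution
has the same values at `0`, so uniqueness applies. -/
theorem pairFreq_neg [Nonempty A] (hρ : IsPrimitiveInflation ρ lam ℓ) {v : A → ℝ}
    (hpos : ∀ i, 0 < v i) (hv : ∀ i, ∑ j, substMatrix ρ i j * v j = lam * v i) (i j : A) (z : ℝ) :
    pairFreq ρ lam ℓ v i j (-z) = pairFreq ρ lam ℓ v j i z := by
  have hmem := pairFreq_mem hρ hpos hv
  have hrefl : (fun i j z => pairFreq ρ lam ℓ v j i (-z)) ∈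
      solutionSpace ρ lam ℓ (superDist ρ ℓ) := by
    have hRE := hmem.2
    refine ⟨fun i j z hz => neg_mem_superDist.1 (hmem.1 j i hz),
      satisfiesRE_iff.2 fun m n z => ?_⟩
    rw [satisfiesRE_iff] at hRE
    refine (hRE n m (-z)).trans ?_
    rw [renorm, Finset.sum_comm]
    refine congrArg (1 / lam * ·) ?_
    refine Finset.sum_congr rfl fun i _ => Finset.sum_congr rfl fun j _ => ?_
    rw [Finset.sum_comm]
    refine Finset.sum_congr rfl fun x _ => Finset.sum_congr rfl fun y _ => ?_
    exact congrArg (pairFreq ρ lam ℓ v j i) (by ring)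
  have h := eq_zero_of_apply_zero hρ hpos hv (sub_mem hrefl hmem) fun i => by simp
  have := congrFun (congrFun (congrFun h j) i) z
  simpa [sub_eq_zero] using this

end Solutions

end PairCorr

/-! ### The main theorem -/

theorem theorem3p5 {A : Type*} [Fintype A] [DecidableEq A]
    (ρ : A → List A) (lam : ℝ) (ℓ : A → ℝ)
    (hρ : PairCorr.IsPrimitiveInflation ρ lam ℓ) :
    (∀ Δ : A → A → Set ℝ,
      PairCorr.IsLocallyFinite (⋃ i, ⋃ j, Δ i j) → (0 : ℝ) ∈ (⋃ i, ⋃ j, Δ i j) →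
        FiniteDimensional ℝ (PairCorr.solutionSpace ρ lam ℓ Δ)) ∧
    ∀ T : A → Set ℝ, PairCorr.IsFixedPointTiling ρ lam ℓ T → ∀ Λ ∈ PairCorr.hull T,
      (∀ Δ : A → A → Set ℝ,
        PairCorr.IsLocallyFinite (⋃ i, ⋃ j, Δ i j) → (0 : ℝ) ∈ (⋃ i, ⋃ j, Δ i j) →
          (∀ i j, PairCorr.distSet Λ i j ⊆ Δ i j) →
            Nontrivial (PairCorr.solutionSpace ρ lam ℓ Δ)) ∧
      Module.finrank ℝ (PairCorr.solutionSpace ρ lam ℓ (PairCorr.distSet Λ)) = 1 ∧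
      (∃ ν ∈ PairCorr.solutionSpace ρ lam ℓ (PairCorr.distSet Λ),
        (∑ i, ν i i 0 = 1) ∧
        (∀ ν' ∈ PairCorr.solutionSpace ρ lam ℓ (PairCorr.distSet Λ),
          ∑ i, ν' i i 0 = 1 → ν' = ν) ∧
        (∀ i j, ∀ z ∈ PairCorr.distSet Λ i j, 0 < ν i j z) ∧
        (∀ i j z, ν i j (-z) = ν j i z)) ∧
      (∀ Δ : A → A → Set ℝ,
        (∀ i j, Δ i j ⊆ PairCorr.distSet Λ i j) → (∃ i j, Δ i j ≠ PairCorr.distSet Λ i j) →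
          PairCorr.solutionSpace ρ lam ℓ Δ = ⊥) := by
  refine ⟨fun Δ hΔ _ => PairCorr.finiteDimensional_solutionSpace hρ hΔ, fun T hT Λ hΛ => ?_⟩
  obtain ⟨⟨-, a⟩, -⟩ := (hT.tiling 0).exists
  have : Nonempty A := ⟨a⟩
  obtain ⟨v, hpos, hv, hsum⟩ := PairCorr.exists_pos_eigenvector hρ
  have hmem := PairCorr.pairFreq_mem hρ hpos hv
  have hspan := fun ν hν => PairCorr.exists_eq_smul_pairFreq hρ hpos hv (ν := ν) hν
  have hzero := PairCorr.pairFreq_self_zero hρ hv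
  have hne : PairCorr.pairFreq ρ lam ℓ v ≠ 0 := fun h =>
    (hpos a).ne' (by rw [← hzero a, h]; rfl)
  have hmono : ∀ {Δ Δ' : A → A → Set ℝ}, (∀ i j, Δ i j ⊆ Δ' i j) →
      PairCorr.solutionSpace ρ lam ℓ Δ ≤ PairCorr.solutionSpace ρ lam ℓ Δ' :=
    fun h ν hν => ⟨fun i j => (hν.1 i j).trans (h i j), hν.2⟩
  rw [PairCorr.distSet_eq_superDist hρ hT hΛ]
  refine ⟨fun Δ _ _ hΔ => ?_, ?_, ⟨PairCorr.pairFreq ρ lam ℓ v, hmem, ?_, ?_, ?_, ?_⟩, ?_⟩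
  · exact ⟨⟨_, hmono hΔ hmem⟩, 0, fun h => hne (congrArg Subtype.val h)⟩
  · refine finrank_eq_one ⟨_, hmem⟩ (fun h => hne (congrArg Subtype.val h)) fun ν => ?_
    obtain ⟨t, ht⟩ := hspan ν ν.2
    exact ⟨t, Subtype.ext ht⟩
  · simp only [hzero, hsum]
  · intro ν' hν' h1
    obtain ⟨t, rfl⟩ := hspan ν' hν'
    simp only [Pi.smul_apply, smul_eq_mul, ← Finset.mul_sum, hzero, hsum, mul_one] at h1
    rw [h1, one_smul]
  · exact fun i j z hz => PairCorr.pairFreq_pos hρ hpos hv hz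
  · exact PairCorr.pairFreq_neg hρ hpos hv
  · rintro Δ hΔ ⟨i, j, hij⟩
    rw [eq_bot_iff]
    intro ν hν
    obtain ⟨t, rfl⟩ := hspan ν (hmono hΔ hν)
    -- At a missing distance `z` the solution is zero but `pairFreq` is not, which forces `t = 0`.
    obtain ⟨z, hz, hzΔ⟩ := Set.exists_of_ssubset ((hΔ i j).ssubset_of_ne hij)
    have h0 : t * PairCorr.pairFreq ρ lam ℓ v i j z = 0 :=
      by_contra fun h => hzΔ (hν.1 i j h)
    rw [(mul_eq_zero.1 h0).resolve_right (PairCorr.pairFreq_pos hρ hpos hv hz).ne', zero_smul]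
    exact zero_mem _
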